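/- Let $(R,\mathfrak m)$ be a commutative noetherian local ring with $\mathfrak m$-adic completion $\widehat R$. Call an $\widehat R$-module algebraic if it is isomorphic, as an $\widehat R$-module, to the $\mathfrak m$-adic completion $\widehat N$ of some finitely generated $R$-module $N$. Let $\mathcal M$ be a finitely generated $\widehat R$-module of finite projective dimension such that $\operatorname{Ext}^i_{\widehat R}(\mathcal M,\widehat R)$ is an $\widehat R$-module of finite length for every $i>0$. Then $\mathcal M$ is strongly algebraic: every direct summand of $\mathcal M$ (in particular $\mathcal M$ itself) is algebraic. -/

import Mathlib

universe u v

/-- The completion of a local ring with respect to the topology of its maximal ideal. -/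
abbrev LocalCompletion (R : Type u) [CommRing R] [IsLocalRing R] : Type u :=
  AdicCompletion (IsLocalRing.maximalIdeal R) R

/-- A module over the completion of `R` is algebraic if it is isomorphic, over the completion of
`R`, to the completion of a finitely generated `R`-module. -/
def IsAlgebraicModule (R : Type u) [CommRing R] [IsLocalRing R]
    (M : Type v) [AddCommGroup M] [Module (LocalCompletion R) M] : Prop :=
  ∃ (N : Type u) (_ : AddCommGroup N) (_ : Module R N), Module.Finite R N ∧
    Nonempty (AdicCompletion (IsLocalRing.maximalIdeal R) N ≃ₗ[LocalCompletion R] M)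

/-- A module over the completion of `R` is strongly algebraic if each of its direct summands
(itself included) is algebraic. -/
def IsStronglyAlgebraicModule (R : Type u) [CommRing R] [IsLocalRing R]
    (M : Type v) [AddCommGroup M] [Module (LocalCompletion R) M] : Prop :=
  ∀ P Q : Submodule (LocalCompletion R) M, IsCompl P Q → IsAlgebraicModule R P

/-- The module `M` has finite projective dimension over `S`. The zero module is included. -/
def HasFiniteProjectiveDimension (S : Type u) [CommRing S]
    (M : Type u) [AddCommGroup M] [Module S M] : Prop :=
  ∃ n : ℕ, CategoryTheory.HasProjectiveDimensionLE (ModuleCat.of S M) n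

/-- The `i`-th Ext module of `M` with values in the ring `S`. -/
abbrev ExtIntoRing (S : Type u) [CommRing S]
    (M : Type u) [AddCommGroup M] [Module S M] (i : ℕ) : Type u :=
  CategoryTheory.Abelian.Ext (ModuleCat.of S M) (ModuleCat.of S S) i

open IsLocalRing TensorProduct CategoryTheory Abelian

/-! Write `S` for the completion of `R`, with maximal ideal `m`, and induct on projective dimension;
dimension 0 is the free case. Otherwise cover `M` by `F = S^d`. By dimension shifting, induction
applies to the kernel, giving `φ : S ⊗ N → F` with cokernel `M`. As `m ^ c` kills `Ext¹(M, S)`,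
multiples of maps `S ⊗ N → F` by `m ^ c` factor through `φ`. By density of `R` and flat base change
of Hom, `φ = ψ_S + u` with `ψ` over `R` and `u ∈ m ^ (c + 1) Hom`. So `u = A φ` with `A ∈ m End F`,
and `ψ_S = (1 - A) φ` with `1 - A` invertible by Nakayama: `M` is the base change of `coker ψ`.
Direct summands inherit the hypotheses. -/

/-! ### Completions and Nakayama arguments. -/

/-- The completion of a noetherian ring at an ideal is noetherian, being a quotient of a power
series ring. -/
theorem AdicCompletion.isNoetherianRing_self {R : Type*} [CommRing R] [IsNoetherianRing R]
    (I : Ideal R) : IsNoetherianRing (AdicCompletion I R) := by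
  have hfg : I.FG := I.fg_of_isNoetherianRing
  set S := AdicCompletion I R
  set J : Ideal S := I.map (algebraMap R S)
  have hc : IsAdicComplete J S := AdicCompletion.isAdicComplete_self I hfg
  let _ : WithIdeal S := ⟨J⟩
  have hct := (IsAdic.isAdicComplete_iff (I := J) (R := S) rfl).1 hc
  have := hct.1
  have := hct.2
  -- With `R` discrete the structure map is continuous, so power series can be evaluated at
  -- generators of `I`.
  let _ : UniformSpace R := ⊥
  have : DiscreteTopology R := ⟨rfl⟩
  have : IsUniformAddGroup R := inferInstance
  obtain ⟨n, a, ha⟩ := Submodule.fg_iff_exists_fin_generating_family.1 hfg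
  have hJ : J = Ideal.span (Set.range fun i ↦ algebraMap R S (a i)) := by
    rw [Set.range_comp' (algebraMap R S) a, ← Ideal.map_span]
    exact congrArg (Ideal.map (algebraMap R S)) ha.symm
  have hmem (i : Fin n) : algebraMap R S (a i) ∈ J :=
    hJ ▸ Ideal.subset_span ⟨i, rfl⟩
  have heval : MvPowerSeries.HasEval fun i ↦ algebraMap R S (a i) := by
    refine ⟨fun i ↦ ?_, by simp⟩
    refine (J.hasBasis_nhds_zero_adic).tendsto_right_iff.2 fun k _ ↦ ?_
    filter_upwards [Filter.eventually_ge_atTop k] with l hl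
    exact Ideal.pow_le_pow_right hl (Ideal.pow_mem_pow (hmem i) l)
  let f : MvPowerSeries (Fin n) R →+* S :=
    MvPowerSeries.eval₂Hom (φ := algebraMap R S) continuous_of_discreteTopology heval
  have hfX (i : Fin n) : f (MvPowerSeries.X i) = algebraMap R S (a i) := by
    simp [f, MvPowerSeries.coe_eval₂Hom]
  have hfC (r : R) : f (MvPowerSeries.C r) = algebraMap R S r := by
    simp [f, MvPowerSeries.coe_eval₂Hom]
  have hmap : (Ideal.span (Set.range MvPowerSeries.X) : Ideal (MvPowerSeries (Fin n) R)).map f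
      = J := by
    rw [Ideal.map_span, ← Set.range_comp, hJ]
    exact congrArg (fun g : Fin n → S ↦ Ideal.span (Set.range g)) (funext hfX)
  have : IsHausdorff ((Ideal.span (Set.range MvPowerSeries.X) :
      Ideal (MvPowerSeries (Fin n) R)).map f) S := by
    rw [hmap]; infer_instance
  have hsurj : Function.Surjective f := by
    -- Completeness of the power series ring and separatedness of `S` reduce surjectivity to the
    -- quotient by `J`, where constants suffice.
    refine surjective_of_mk_map_comp_surjective
      (I := (Ideal.span (Set.range MvPowerSeries.X) : Ideal (MvPowerSeries (Fin n) R))) f ?_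
    rw [hmap]
    intro y
    obtain ⟨s, rfl⟩ := Ideal.Quotient.mk_surjective y
    obtain ⟨r, hr⟩ := Ideal.Quotient.mk_surjective (AdicCompletion.evalOneₐ I s)
    refine ⟨MvPowerSeries.C r, ?_⟩
    rw [RingHom.comp_apply, hfC, Ideal.Quotient.eq]
    change _ ∈ I.map (algebraMap R (AdicCompletion I R))
    rw [← AdicCompletion.ker_evalOneₐ_eq_map I hfg, RingHom.mem_ker, map_sub, sub_eq_zero]
    refine Eq.trans ?_ hr
    exact DFunLike.congr_fun (AdicCompletion.evalOneₐ_comp_algebraMap_eq_mk I) r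
  exact isNoetherianRing_of_surjective _ _ f hsurj

/-- A ring is dense in its adic completion. -/
theorem AdicCompletion.exists_sub_algebraMap_mem_pow {R : Type*} [CommRing R] {I : Ideal R}
    (hI : I.FG) (s : AdicCompletion I R) (k : ℕ) :
    ∃ r : R, s - algebraMap R (AdicCompletion I R) r ∈
      (I.map (algebraMap R (AdicCompletion I R))) ^ k := by
  obtain ⟨r, hr⟩ := Submodule.Quotient.mk_surjective _ (AdicCompletion.eval I R k s)
  refine ⟨r, ?_⟩
  have h : s - algebraMap R (AdicCompletion I R) r ∈ (AdicCompletion.eval I R k).ker := by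
    rw [LinearMap.mem_ker, map_sub, sub_eq_zero, ← hr]
    rfl
  rw [← AdicCompletion.pow_smul_top_eq_ker_eval hI] at h
  rwa [← Ideal.map_pow, ← Submodule.restrictScalars_mem R, ← Ideal.smul_top_eq_map]

/-- A module of finite length over a local ring is annihilated by a power of the maximal ideal. -/
theorem IsFiniteLength.exists_pow_maximalIdeal_smul_eq_zero {S : Type*} [CommRing S]
    [IsLocalRing S] {E : Type*} [AddCommGroup E] [Module S E] (h : IsFiniteLength S E) :
    ∃ c : ℕ, ∀ a ∈ maximalIdeal S ^ c, ∀ x : E, a • x = 0 := by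
  obtain ⟨_, _⟩ := isFiniteLength_iff_isNoetherian_isArtinian.1 h
  let f : ℕ →o (Submodule S E)ᵒᵈ :=
    ⟨fun k ↦ OrderDual.toDual (maximalIdeal S ^ k • ⊤), fun i j hij ↦
      Submodule.smul_mono_left (Ideal.pow_le_pow_right hij)⟩
  obtain ⟨c, hc⟩ := IsArtinian.monotone_stabilizes f
  have h1 : maximalIdeal S ^ c • (⊤ : Submodule S E) = maximalIdeal S ^ (c + 1) • ⊤ :=
    hc (c + 1) (Nat.le_succ c)
  have h2 : maximalIdeal S ^ c • (⊤ : Submodule S E) = ⊥ := by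
    refine Submodule.eq_bot_of_le_smul_of_le_jacobson_bot (maximalIdeal S) _
      (IsNoetherian.noetherian _) ?_ (IsLocalRing.maximalIdeal_le_jacobson _)
    rw [← mul_smul, ← pow_succ', ← h1]
  exact ⟨c, fun a ha x ↦ by
    simpa [h2] using Submodule.smul_mem_smul ha (Submodule.mem_top (x := x))⟩

/-- An endomorphism of a finite module over a local ring which is the identity modulo the maximal
ideal is bijective. -/
theorem LinearMap.bijective_of_sub_mem_maximalIdeal_smul {S : Type*} [CommRing S] [IsLocalRing S]
    {F : Type*} [AddCommGroup F] [Module S F] [Module.Finite S F] (g : F →ₗ[S] F)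
    (h : ∀ x, x - g x ∈ maximalIdeal S • (⊤ : Submodule S F)) : Function.Bijective g := by
  have hs : Function.Surjective g := by
    rw [← LinearMap.range_eq_top, eq_top_iff]
    refine Submodule.le_of_le_smul_of_le_jacobson_bot (Module.Finite.fg_top)
      (IsLocalRing.maximalIdeal_le_jacobson _) fun x _ ↦ ?_
    rw [← add_sub_cancel (g x) x]
    exact Submodule.add_mem_sup (LinearMap.mem_range_self g x) (h x)
  exact ⟨OrzechProperty.injective_of_surjective_endomorphism g hs, hs⟩

/-! ### Approximating maps by maps defined over `R`. -/

section Approximation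

variable {R S : Type*} [CommRing R] [CommRing S] [Algebra R S]

/-- If `R` is dense in `S`, every element of an extended module is approximated by elements of the
original module. -/
theorem IsBaseChange.exists_eq_add_mem_pow_smul [IsLocalRing S]
    (hdense : ∀ (s : S) (k : ℕ), ∃ r : R, s - algebraMap R S r ∈ maximalIdeal S ^ k)
    {H T : Type*} [AddCommMonoid H] [Module R H] [AddCommMonoid T] [Module R T] [Module S T]
    [IsScalarTower R S T] {f : H →ₗ[R] T} (hf : IsBaseChange S f) (t : T) (k : ℕ) :
    ∃ h : H, ∃ u ∈ maximalIdeal S ^ k • (⊤ : Submodule S T), t = f h + u := by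
  induction t using hf.inductionOn with
  | zero => exact ⟨0, 0, zero_mem _, by simp⟩
  | tmul h => exact ⟨h, 0, zero_mem _, by simp⟩
  | smul s t ih =>
    obtain ⟨h, u, hu, rfl⟩ := ih
    obtain ⟨r, hr⟩ := hdense s k
    refine ⟨r • h, (s - algebraMap R S r) • f h + s • u,
      add_mem (Submodule.smul_mem_smul hr trivial) (Submodule.smul_mem _ _ hu), ?_⟩
    rw [map_smul, smul_add, ← add_assoc, ← algebraMap_smul S r (f h), ← add_smul,
      add_sub_cancel]
  | add t₁ t₂ h₁ h₂ =>
    obtain ⟨h₁, u₁, hu₁, rfl⟩ := h₁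
    obtain ⟨h₂, u₂, hu₂, rfl⟩ := h₂
    exact ⟨h₁ + h₂, u₁ + u₂, add_mem hu₁ hu₂, by rw [map_add, add_add_add_comm]⟩

/-- If multiples of maps `K → F` by the `c`-th power of the maximal ideal factor through `φ`, then
maps congruent to `φ` modulo the next power agree with `φ` up to an automorphism of `F`. -/
theorem LinearMap.exists_equiv_comp_of_eq_add_mem_pow_smul [IsLocalRing S]
    {K F : Type*} [AddCommMonoid K] [Module S K] [AddCommMonoid F] [Module S F]
    [Module.Finite S F] (φ φ' u : K →ₗ[S] F) (c : ℕ)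
    (h : ∀ a ∈ maximalIdeal S ^ c, ∀ f : K →ₗ[S] F, ∃ g : F →ₗ[S] F, a • f = g ∘ₗ φ)
    (hu : u ∈ maximalIdeal S ^ (c + 1) • (⊤ : Submodule S (K →ₗ[S] F))) (hφ : φ = φ' + u) :
    ∃ e : F ≃ₗ[S] F, φ' = e.toLinearMap ∘ₗ φ := by
  let _ : AddCommGroup F := Module.addCommMonoidToAddCommGroup S
  have hle : maximalIdeal S ^ c • (⊤ : Submodule S (K →ₗ[S] F)) ≤
      (⊤ : Submodule S (F →ₗ[S] F)).map (φ.lcomp S F) := by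
    refine Submodule.smul_le.2 fun a ha f _ ↦ ?_
    obtain ⟨g, hg⟩ := h a ha f
    exact ⟨g, trivial, hg.symm⟩
  -- The exponent `c + 1` leaves one spare factor of the maximal ideal, which puts `A` in `m End F`.
  rw [pow_succ', mul_smul] at hu
  have hu' := Submodule.smul_mono le_rfl hle hu
  rw [← Submodule.map_smul''] at hu'
  obtain ⟨A, hA, hAφ⟩ := hu'
  have hAx (x : F) : A x ∈ maximalIdeal S • (⊤ : Submodule S F) := by
    have := Submodule.mem_map_of_mem (f := LinearMap.applyₗ x) hA
    rw [Submodule.map_smul''] at this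
    exact Submodule.smul_mono le_rfl le_top this
  have hbij : Function.Bijective (LinearMap.id - A : F →ₗ[S] F) :=
    bijective_of_sub_mem_maximalIdeal_smul (LinearMap.id - A : F →ₗ[S] F) fun x ↦ by
      simpa using hAx x
  refine ⟨LinearEquiv.ofBijective _ hbij, LinearMap.ext fun n ↦ ?_⟩
  have hAn : A (φ n) = u n := LinearMap.congr_fun hAφ n
  have hφn : φ n = φ' n + u n := LinearMap.congr_fun hφ n
  change φ' n = φ n - A (φ n)
  rw [hAn, hφn, add_sub_cancel_right]

/-- A linear map `φ` between extended modules is, up to an automorphism of the target, defined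
over `R`, provided that multiples of maps by a power of the maximal ideal factor through `φ`. -/
theorem LinearMap.exists_baseChange_eq_equiv_comp [IsLocalRing S] [IsNoetherianRing R]
    [Module.Flat R S]
    (hdense : ∀ (s : S) (k : ℕ), ∃ r : R, s - algebraMap R S r ∈ maximalIdeal S ^ k)
    {N P : Type*} [AddCommGroup N] [Module R N] [Module.Finite R N] [AddCommGroup P] [Module R P]
    [Module.Finite R P] (φ : S ⊗[R] N →ₗ[S] S ⊗[R] P) (c : ℕ)
    (h : ∀ a ∈ maximalIdeal S ^ c, ∀ f : S ⊗[R] N →ₗ[S] S ⊗[R] P,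
      ∃ g : S ⊗[R] P →ₗ[S] S ⊗[R] P, a • f = g ∘ₗ φ) :
    ∃ (ψ : N →ₗ[R] P) (e : (S ⊗[R] P) ≃ₗ[S] S ⊗[R] P), ψ.baseChange S = e.toLinearMap ∘ₗ φ := by
  have : Module.FinitePresentation R N := Module.finitePresentation_of_finite R N
  obtain ⟨ψ, u, hu, hφ⟩ :=
    (Module.FinitePresentation.isBaseChange_map R N P S).exists_eq_add_mem_pow_smul
      hdense φ (c + 1)
  exact ⟨ψ, exists_equiv_comp_of_eq_add_mem_pow_smul φ (ψ.baseChange S) u c h hu hφ⟩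

/-- If a map between extended modules is, up to an automorphism of the target, defined over `R`,
then so is its cokernel. -/
theorem LinearMap.nonempty_baseChange_coker_equiv {N P M : Type*} [AddCommGroup N] [Module R N]
    [AddCommGroup P] [Module R P] [AddCommGroup M] [Module S M]
    (φ : S ⊗[R] N →ₗ[S] S ⊗[R] P) (p : S ⊗[R] P →ₗ[S] M) (hp : Function.Surjective p)
    (hφp : Function.Exact φ p) (ψ : N →ₗ[R] P) (e : (S ⊗[R] P) ≃ₗ[S] S ⊗[R] P)
    (he : ψ.baseChange S = e.toLinearMap ∘ₗ φ) :
    Nonempty ((S ⊗[R] (P ⧸ LinearMap.range ψ)) ≃ₗ[S] M) := by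
  let q : S ⊗[R] P →ₗ[S] S ⊗[R] (P ⧸ LinearMap.range ψ) :=
    (LinearMap.range ψ).mkQ.baseChange S
  have hq : Function.Surjective q :=
    LinearMap.lTensor_surjective S (Submodule.mkQ_surjective _)
  have hψq : Function.Exact (ψ.baseChange S) q :=
    lTensor_exact S (LinearMap.exact_map_mkQ_range ψ) (Submodule.mkQ_surjective _)
  have hker : (LinearMap.ker p).map e.toLinearMap = LinearMap.ker q := by
    rw [LinearMap.exact_iff.1 hφp, LinearMap.exact_iff.1 hψq, he, LinearMap.range_comp]
  exact ⟨((p.quotKerEquivOfSurjective hp).symm ≪≫ₗ Submodule.Quotient.equiv _ _ e hker ≪≫ₗ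
    q.quotKerEquivOfSurjective hq).symm⟩

end Approximation

/-! ### Annihilators of Ext. -/

namespace CategoryTheory.ShortComplex.ShortExact

variable {S : Type u} [CommRing S] {X : ShortComplex (ModuleCat.{u} S)} (hX : X.ShortExact)

include hX in
/-- An element annihilating `Ext¹` of the cokernel of `X.f` with values in `Y` multiplies maps
into `Y` to maps extending along `X.f`. -/
theorem exists_smul_eq_comp {Y : ModuleCat.{u} S} {a : S}
    (ha : ∀ x : Ext X.X₃ Y 1, a • x = 0) (f : X.X₁ ⟶ Y) : ∃ g : X.X₂ ⟶ Y, a • f = X.f ≫ g := by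
  -- The obstruction to extending `a • f` is `a` times a class in `Ext¹`, hence zero.
  obtain ⟨x, hx⟩ := Ext.contravariant_sequence_exact₁ hX Y (Ext.mk₀ (a • f)) (n₁ := 1) rfl
    (by rw [Ext.mk₀_smul, Ext.comp_smul, ha])
  obtain ⟨g, rfl⟩ := Ext.homEquiv₀.symm.surjective x
  refine ⟨g, Ext.homEquiv₀.symm.injective ?_⟩
  simpa using hx.symm

include hX in
/-- Dimension shifting for annihilators of `Ext`. -/
theorem smul_ext_eq_zero [Projective X.X₂] {Y : ModuleCat.{u} S} {a : S} {i : ℕ} (hi : 0 < i)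
    (ha : ∀ x : Ext X.X₃ Y (i + 1), a • x = 0) (x : Ext X.X₁ Y i) : a • x = 0 := by
  obtain ⟨y, hy⟩ := Ext.contravariant_sequence_exact₁ hX Y (a • x) (add_comm 1 i)
    (by rw [Ext.comp_smul, ha])
  rw [← hy, y.eq_zero_of_hasProjectiveDimensionLT 1 hi, Ext.comp_zero]

end CategoryTheory.ShortComplex.ShortExact

/-- Annihilators of `Ext` pass to retracts in the first variable. -/
theorem CategoryTheory.Retract.smul_ext_eq_zero {S : Type u} [CommRing S]
    {X X' Y : ModuleCat.{u} S} (h : Retract X X') {a : S} {i : ℕ}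
    (ha : ∀ x : Ext X' Y i, a • x = 0) (x : Ext X Y i) : a • x = 0 := by
  rw [← x.mk₀_id_comp, ← h.retract, ← Ext.mk₀_comp_mk₀, Ext.comp_assoc_of_second_deg_zero,
    ← Ext.comp_smul, ha, Ext.comp_zero]

section KernelShortComplex

variable {S : Type u} [CommRing S] {F M : Type u} [AddCommGroup F] [Module S F] [AddCommGroup M]
  [Module S M]

/-- The short complex `ker p → F → M`. -/
abbrev LinearMap.kerShortComplex (p : F →ₗ[S] M) : ShortComplex (ModuleCat.{u} S) :=
  ShortComplex.mk (ModuleCat.ofHom (LinearMap.ker p).subtype) (ModuleCat.ofHom p)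
    (by ext x; exact x.2)

/-- The short complex `ker p → F → M` is short exact when `p` is surjective. -/
theorem LinearMap.kerShortComplex_shortExact {p : F →ₗ[S] M} (hp : Function.Surjective p) :
    p.kerShortComplex.ShortExact where
  exact := (ShortComplex.ShortExact.moduleCat_exact_iff_function_exact _).2
    (LinearMap.exact_subtype_ker_map p)
  mono_f := (ModuleCat.mono_iff_injective _).2 (Submodule.injective_subtype _)
  epi_g := (ModuleCat.epi_iff_surjective _).2 hp

end KernelShortComplex

/-! ### Descent by induction on projective dimension. -/

/-- A finite projective module over a local `R`-algebra is extended from `R`. -/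
theorem exists_finite_baseChange_equiv_of_projective (R : Type u) {S M : Type u} [CommRing R]
    [CommRing S] [IsLocalRing S] [Algebra R S] [AddCommGroup M] [Module S M] [Module.Finite S M]
    [Module.Projective S M] :
    ∃ (N : Type u) (_ : AddCommGroup N) (_ : Module R N), Module.Finite R N ∧
      Nonempty ((S ⊗[R] N) ≃ₗ[S] M) := by
  have : Module.Free S M := Module.free_of_flat_of_isLocalRing
  let b := Module.finBasis S M
  exact ⟨Fin (Module.finrank S M) → R, inferInstance, inferInstance, inferInstance,
    ⟨TensorProduct.piScalarRight R S S _ ≪≫ₗ b.equivFun.symm⟩⟩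

/-- If `R` is dense in the flat local extension `S`, a finite `S`-module of finite projective
dimension is extended from `R` as soon as each `Ext` with values in `S` in positive degree is
annihilated by a power of the maximal ideal. -/
theorem exists_finite_baseChange_equiv {R S : Type u} [CommRing R] [IsNoetherianRing R]
    [CommRing S] [IsLocalRing S] [IsNoetherianRing S] [Algebra R S] [Module.Flat R S]
    (hdense : ∀ (s : S) (k : ℕ), ∃ r : R, s - algebraMap R S r ∈ maximalIdeal S ^ k) (n : ℕ)
    (M : Type u) [AddCommGroup M] [Module S M] [Module.Finite S M]
    (hpd : HasProjectiveDimensionLE (ModuleCat.of S M) n)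
    (hExt : ∀ i : ℕ, 0 < i → ∃ c : ℕ, ∀ a ∈ maximalIdeal S ^ c,
      ∀ x : Ext (ModuleCat.of S M) (ModuleCat.of S S) i, a • x = 0) :
    ∃ (N : Type u) (_ : AddCommGroup N) (_ : Module R N), Module.Finite R N ∧
      Nonempty ((S ⊗[R] N) ≃ₗ[S] M) := by
  induction n generalizing M with
  | zero =>
    rw [← projective_iff_hasProjectiveDimensionLE_zero, ← IsProjective.iff_projective] at hpd
    exact exists_finite_baseChange_equiv_of_projective R
  | succ n ih =>
    obtain ⟨d, p, hp⟩ := Module.Finite.exists_fin' S M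
    have hX := LinearMap.kerShortComplex_shortExact hp
    have hproj : Projective p.kerShortComplex.X₂ :=
      (IsProjective.iff_projective (R := S) (Fin d → S)).1 inferInstance
    obtain ⟨N, _, _, _, ⟨e⟩⟩ := ih (LinearMap.ker p)
      ((hX.hasProjectiveDimensionLT_X₃_iff n hproj).1 hpd) fun i hi ↦ by
        obtain ⟨c, hc⟩ := hExt (i + 1) i.succ_pos
        exact ⟨c, fun a ha ↦ hX.smul_ext_eq_zero hi (hc a ha)⟩
    obtain ⟨c, hc⟩ := hExt 1 one_pos
    let ε := TensorProduct.piScalarRight R S S (Fin d)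
    let φ : S ⊗[R] N →ₗ[S] S ⊗[R] (Fin d → R) :=
      ε.symm.toLinearMap ∘ₗ (LinearMap.ker p).subtype ∘ₗ e.toLinearMap
    have hφp : Function.Exact φ (p ∘ₗ ε.toLinearMap) := by
      intro y
      constructor
      · intro hy
        refine ⟨e.symm ⟨ε y, hy⟩, ?_⟩
        simp [φ]
      · rintro ⟨z, rfl⟩
        simp [φ]
    obtain ⟨ψ, e', he'⟩ := LinearMap.exists_baseChange_eq_equiv_comp hdense φ c fun a ha f ↦ by
      -- The annihilator is known only for Ext into `S`, so maps into `S^d` are factored one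
      -- coordinate at a time.
      have (i : Fin d) : ∃ g : (Fin d → S) →ₗ[S] S,
          ∀ y, a • ε (f y) i = g (ε (φ y)) := by
        obtain ⟨g, hg⟩ := hX.exists_smul_eq_comp (hc a ha)
          (ModuleCat.ofHom (LinearMap.proj i ∘ₗ ε.toLinearMap ∘ₗ f ∘ₗ e.symm.toLinearMap))
        refine ⟨g.hom, fun y ↦ ?_⟩
        have := LinearMap.congr_fun (congrArg ModuleCat.Hom.hom hg) (e y)
        simpa [φ] using this
      choose g hg using this
      refine ⟨ε.symm.toLinearMap ∘ₗ LinearMap.pi g ∘ₗ ε.toLinearMap,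
        LinearMap.ext fun y ↦ ε.injective (funext fun i ↦ ?_)⟩
      simpa using hg i y
    exact ⟨(Fin d → R) ⧸ LinearMap.range ψ, inferInstance, inferInstance, inferInstance,
      LinearMap.nonempty_baseChange_coker_equiv φ (p ∘ₗ ε.toLinearMap)
        (hp.comp ε.surjective) hφp ψ e' he'⟩

theorem theorem3p7 (R : Type u) [CommRing R] [IsLocalRing R] [IsNoetherianRing R]
    (M : Type u) [AddCommGroup M] [Module (LocalCompletion R) M]
    [Module.Finite (LocalCompletion R) M]
    (hpd : HasFiniteProjectiveDimension (LocalCompletion R) M)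
    (hExt : ∀ i : ℕ, 0 < i →
      IsFiniteLength (LocalCompletion R) (ExtIntoRing (LocalCompletion R) M i)) :
    IsStronglyAlgebraicModule R M := by
  intro P Q hPQ
  obtain ⟨n, hn⟩ := hpd
  have : IsNoetherianRing (LocalCompletion R) := AdicCompletion.isNoetherianRing_self _
  let r : Retract (ModuleCat.of (LocalCompletion R) P) (ModuleCat.of (LocalCompletion R) M) :=
    { i := ModuleCat.ofHom P.subtype
      r := ModuleCat.ofHom (P.projectionOnto Q hPQ)
      retract := by
        ext x
        exact congrArg Subtype.val (Submodule.projectionOnto_apply_left hPQ x) }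
  have hdense (s : LocalCompletion R) (k : ℕ) : ∃ t : R,
      s - algebraMap R (LocalCompletion R) t ∈ maximalIdeal (LocalCompletion R) ^ k := by
    rw [AdicCompletion.maximalIdeal_eq_map]
    exact AdicCompletion.exists_sub_algebraMap_mem_pow (maximalIdeal R).fg_of_isNoetherianRing s k
  obtain ⟨N, _, _, hN, ⟨e⟩⟩ := exists_finite_baseChange_equiv (R := R) hdense n P
    (r.hasProjectiveDimensionLT (n + 1)) fun i hi ↦ by
      obtain ⟨c, hc⟩ := (hExt i hi).exists_pow_maximalIdeal_smul_eq_zero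
      exact ⟨c, fun a ha ↦ r.smul_ext_eq_zero (hc a ha)⟩
  -- Over a noetherian ring, completing a finite module amounts to base change to the completion.
  exact ⟨N, inferInstance, inferInstance, hN,
    ⟨(AdicCompletion.ofTensorProductEquivOfFiniteNoetherian (maximalIdeal R) N).symm ≪≫ₗ e⟩⟩
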